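/- For every $d\ge 1$ let $p_d(x,z)$ be the joint density (at a fixed parameter $\theta$ and a fixed observation $x$, both allowed to depend on $d$) of a model with latent variable $z\in\mathbb R^d$, with $0<p_d(x)=\int p_d(x,z)\,dz<\infty$, and let $q_d(z)$ be a probability density on $\mathbb R^d$ (the variational distribution). Put $w_d(z)=p_d(x,z)/q_d(z)$ and $\overline w_d(z)=w_d(z)/p_d(x)$. Let $\sigma>0$ and assume that the weights are exactly log-normal with parameter $\sigma\sqrt d$: for every $d\ge1$ there is a function $S_d:\mathbb R^d\to\mathbb R$ such that, for $z\sim q_d$, $S_d(z)\sim\mathcal N(0,1)$ and almost surely $$\log\overline w_d(z)=-\frac{\sigma^2d}{2}-\sigma\sqrt d\,S_d(z).$$ For $\alpha\in[0,1)$ and $N\ge1$ let $$\Delta^{(\alpha)}_{N,d}=\frac1{1-\alpha}\,\mathbb E\left[\log\left(\frac1N\sum_{j=1}^N w_d(z_j)^{1-\alpha}\right)\right]-\log p_d(x),\qquad z_1,\dots,z_N\ \text{i.i.d.}\sim q_d,$$ be the gap between the VR-IWAE bound and the log-likelihood, and let $\mathrm{ELBO}_d=\mathbb E_{z\sim q_d}[\log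 w_d(z)]$, $\ell_d=\log p_d(x)$. Then, for every $\alpha\in[0,1)$, the logarithm in the expectation above is integrable for all $N,d\ge 1$, and there is a remainder $r(N,d)$ with $$r(N,d)=O\left(\frac{\log\log N}{\sqrt{d\log N}}\right)\qquad\text{as } N,d\to\infty,\ \frac{\log N}{d}\to0,$$ such that $$\lim_{\substack{N,d\to\infty\\ \log N/d\to0}}\left[\Delta^{(\alpha)}_{N,d}+\frac{d\sigma^2}{2}\left(1-2\sqrt{\frac{2\log N}{d\sigma^2}}+\frac1{1-\alpha}\,\frac{2\log N}{d\sigma^2}+r(N,d)\right)\right]=0 .$$ In particular, $\mathrm{ELBO}_d-\ell_d=-d\sigma^2/2$ for every $d\ge1$, and the VR-IWAE bound is essentially the ELBO in this regime: $\Delta^{(\alpha)}_{N,d}/(\mathrm{ELBO}_d-\ell_d)\to1$ as $N,d\to\infty$ with $\log N/d\to0$. -/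

import Mathlib

open MeasureTheory ProbabilityTheory Filter Topology Asymptotics

noncomputable section

/-- A latent variable model with a `d`-dimensional latent variable together with a variational
distribution, at fixed parameters `θ`, `φ` and a fixed observation `x`:
`joint z` is the joint density `p_θ(x, z)` as a function of `z`, and `enc z` is the encoder
density `q_φ(z | x)`. The evidence `p_θ(x) = ∫ p_θ(x, z) dz` is positive and finite. -/
structure LatentModel (d : ℕ) where
  joint : EuclideanSpace ℝ (Fin d) → ℝ
  enc : EuclideanSpace ℝ (Fin d) → ℝ
  joint_measurable : Measurable joint
  enc_measurable : Measurable enc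
  joint_nonneg : ∀ z, 0 ≤ joint z
  enc_nonneg : ∀ z, 0 ≤ enc z
  enc_integral : ∫ z, enc z = 1
  joint_integrable : Integrable joint
  joint_integral_pos : 0 < ∫ z, joint z

namespace LatentModel

variable {d : ℕ}

/-- The variational distribution, with Lebesgue density `q_φ(· | x)`. -/
def encMeasure (M : LatentModel d) : Measure (EuclideanSpace ℝ (Fin d)) :=
  volume.withDensity (fun z => ENNReal.ofReal (M.enc z))

/-- The joint law of `N` independent samples `z_1, …, z_N` from the variational distribution. -/
def sampleMeasure (M : LatentModel d) (N : ℕ) :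
    Measure (Fin N → EuclideanSpace ℝ (Fin d)) :=
  Measure.pi (fun _ => M.encMeasure)

/-- The evidence `p_θ(x)`. -/
def evidence (M : LatentModel d) : ℝ := ∫ z, M.joint z

/-- The marginal log-likelihood `ℓ(θ; x) = log p_θ(x)`. -/
def logLik (M : LatentModel d) : ℝ := Real.log M.evidence

/-- The importance weight `w(z) = p_θ(x, z) / q_φ(z | x)`. -/
def weight (M : LatentModel d) (z : EuclideanSpace ℝ (Fin d)) : ℝ := M.joint z / M.enc z

/-- The relative weight `w(z) / p_θ(x)`. -/
def relWeight (M : LatentModel d) (z : EuclideanSpace ℝ (Fin d)) : ℝ := M.weight z / M.evidence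

/-- The evidence lower bound `∫ q_φ(z | x) log w(z) dz`. -/
def elbo (M : LatentModel d) : ℝ := ∫ z, Real.log (M.weight z) ∂M.encMeasure

/-- `log (N⁻¹ ∑_j w(z_j) ^ (1 - α))`, the integrand of the VR-IWAE bound. -/
def logMeanWeight (M : LatentModel d) (α : ℝ) (N : ℕ)
    (z : Fin N → EuclideanSpace ℝ (Fin d)) : ℝ :=
  Real.log ((1 / (N : ℝ)) * ∑ j, M.weight (z j) ^ (1 - α))

/-- The VR-IWAE bound with `N` samples. -/
def vrIwae (M : LatentModel d) (α : ℝ) (N : ℕ) : ℝ :=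
  (1 / (1 - α)) * ∫ z, M.logMeanWeight α N z ∂(M.sampleMeasure N)

/-- The variational gap `Δ_{N,d}^{(α)}`. -/
def gap (M : LatentModel d) (α : ℝ) (N : ℕ) : ℝ := M.vrIwae α N - M.logLik

/-- The relative weights are exactly log-normal: under `z ∼ q_φ(· | x)`,
`log (w(z) / p_θ(x)) = - σ² d / 2 - σ √d S` almost surely, where `S ∼ 𝒩(0, 1)`. -/
def HasLogNormalWeights (M : LatentModel d) (σ : ℝ) : Prop :=
  ∃ S : EuclideanSpace ℝ (Fin d) → ℝ,
    HasLaw S (gaussianReal 0 1) M.encMeasure ∧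
    ∀ᵐ z ∂M.encMeasure,
      Real.log (M.relWeight z) = -(σ ^ 2 * (d : ℝ) / 2) - σ * √(d : ℝ) * S z

end LatentModel

/-- The filter on pairs `(N, d)` expressing `N, d → ∞` with `log N / d → 0`. -/
def subexpRegime : Filter (ℕ × ℕ) :=
  (atTop ×ˢ atTop) ⊓ comap (fun p : ℕ × ℕ => Real.log (p.1 : ℝ) / (p.2 : ℝ)) (𝓝 0)

end

/-! ### Log-sum-exp -/

/-! With `t = (1 - α) σ √d`, log-normality makes the gap exactly `-σ²d/2 - log N / (1 - α) + E / (1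
- α)`, where `E` is the expected log-sum-exp of `t X_j` for `N` independent standard normals
(`HasLogNormalWeights.gap_eq`). Everything reduces to showing `E = t √(2 log N) + O(t log log N /
√(log N))` uniformly in `t ≥ √(2 log N)`, the range where the largest `X_j` dominates the sum
(`exists_expectedLogSumExp_bound`). The regime `log N / d → 0` puts `t` in that range eventually.

The upper bound has no error term: log-sum-exp divided by `t` decreases in `t`, and at `t = √(2 log
N)` Jensen's inequality already gives the claim (`expectedLogSumExp_le`). The lower bound replaces
log-sum-exp by `t` times the maximum, which exceeds a level just below `√(2 log N)` with high
probability (`le_expectedLogSumExp`, `gaussian_tail_lower_bound`). Dividing the error by `dσ²/2`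
turns it into the stated remainder. -/

lemma mul_le_log_sum_exp {ι : Type*} [Fintype ι] (t : ℝ) (x : ι → ℝ) (i : ι) :
    t * x i ≤ Real.log (∑ j, Real.exp (t * x j)) := by
  have h : Real.exp (t * x i) ≤ ∑ j, Real.exp (t * x j) :=
    Finset.single_le_sum (f := fun j => Real.exp (t * x j))
      (fun j _ => (Real.exp_pos _).le) (Finset.mem_univ i)
  calc t * x i = Real.log (Real.exp (t * x i)) := (Real.log_exp _).symm
    _ ≤ _ := Real.log_le_log (Real.exp_pos _) h

/-- Monotonicity of `ℓ^p` norms in `p`: each `exp (s * x j)` is at most the whole sum `Y`, so the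
surplus factor `exp ((t - s) * x j)` is at most `Y ^ ((t - s) / s)`. -/
lemma log_sum_exp_le_mul {ι : Type*} [Fintype ι] [Nonempty ι] {s t : ℝ} (hs : 0 < s) (hst : s ≤ t)
    (x : ι → ℝ) :
    Real.log (∑ j, Real.exp (t * x j)) ≤ t / s * Real.log (∑ j, Real.exp (s * x j)) := by
  set Y := ∑ j, Real.exp (s * x j) with hY
  have hYpos : 0 < Y := Finset.sum_pos (fun j _ => Real.exp_pos _) Finset.univ_nonempty
  have hpos : 0 < ∑ j, Real.exp (t * x j) :=
    Finset.sum_pos (fun j _ => Real.exp_pos _) Finset.univ_nonempty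
  rw [Real.log_le_iff_le_exp hpos]
  have h1 : ∀ j, Real.exp (t * x j) ≤
      Real.exp (s * x j) * Real.exp ((t - s) / s * Real.log Y) := by
    intro j
    rw [← Real.exp_add, Real.exp_le_exp]
    have h2 : (t - s) / s * (s * x j) ≤ (t - s) / s * Real.log Y :=
      mul_le_mul_of_nonneg_left (mul_le_log_sum_exp s x j) (div_nonneg (by linarith) hs.le)
    have h3 : (t - s) / s * (s * x j) = (t - s) * x j := by field_simp
    linarith
  calc ∑ j, Real.exp (t * x j)
      ≤ ∑ j, Real.exp (s * x j) * Real.exp ((t - s) / s * Real.log Y) :=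
        Finset.sum_le_sum fun j _ => h1 j
    _ = Real.exp (Real.log Y) * Real.exp ((t - s) / s * Real.log Y) := by
        rw [← Finset.sum_mul, Real.exp_log hYpos]
    _ = Real.exp (t / s * Real.log Y) := by
        rw [← Real.exp_add]; congr 1; field_simp; ring

/-! ### The expected log-sum-exp of independent standard normal variables -/

/-- The law of `N` independent standard normal variables. -/
noncomputable abbrev stdNormalPi (N : ℕ) : Measure (Fin N → ℝ) :=
  Measure.pi fun _ => gaussianReal 0 1

/-- The expectation of `log ∑ exp (t X_j)` for `N` independent standard normal variables. -/
noncomputable def expectedLogSumExp (N : ℕ) (t : ℝ) : ℝ :=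
  ∫ x, Real.log (∑ j, Real.exp (t * x j)) ∂stdNormalPi N

lemma integrable_id_stdNormal : Integrable (fun x : ℝ => x) (gaussianReal 0 1) :=
  (memLp_id_gaussianReal (μ := 0) (v := 1) 1).integrable (by norm_num)

lemma integrable_eval_stdNormalPi (N : ℕ) (j : Fin N) :
    Integrable (fun x : Fin N → ℝ => x j) (stdNormalPi N) :=
  integrable_comp_eval (μ := fun _ : Fin N => gaussianReal 0 1) (i := j) (f := fun y : ℝ => y)
    integrable_id_stdNormal

lemma integrable_log_sum_exp (N : ℕ) (t : ℝ) :
    Integrable (fun x : Fin N → ℝ => Real.log (∑ j, Real.exp (t * x j))) (stdNormalPi N) := by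
  have hmeas : Measurable (fun x : Fin N → ℝ => Real.log (∑ j, Real.exp (t * x j))) := by
    fun_prop
  refine Integrable.mono' (g := fun x => |t| * ∑ j, |x j| + Real.log N) ?_
    hmeas.aestronglyMeasurable (ae_of_all _ fun x => ?_)
  · exact ((integrable_finsetSum _ fun j _ =>
      (integrable_eval_stdNormalPi N j).abs).const_mul _).add (integrable_const _)
  · rcases Nat.eq_zero_or_pos N with rfl | hN
    · simp
    have : Nonempty (Fin N) := ⟨⟨0, hN⟩⟩
    have hN1 : (1 : ℝ) ≤ N := by exact_mod_cast hN
    have hlog : 0 ≤ Real.log N := Real.log_nonneg hN1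
    have hj : ∀ j, |t * x j| ≤ |t| * ∑ j, |x j| := fun j => by
      rw [abs_mul]
      exact mul_le_mul_of_nonneg_left (Finset.single_le_sum (f := fun j => |x j|)
        (fun j _ => abs_nonneg _) (Finset.mem_univ j)) (abs_nonneg _)
    rw [Real.norm_eq_abs, abs_le]
    constructor
    · have := mul_le_log_sum_exp t x ⟨0, hN⟩
      have := neg_le_of_abs_le (hj ⟨0, hN⟩)
      linarith
    · rw [Real.log_le_iff_le_exp
        (Finset.sum_pos (fun j _ => Real.exp_pos _) Finset.univ_nonempty), Real.exp_add,
        Real.exp_log (by linarith)]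
      calc ∑ j, Real.exp (t * x j) ≤ ∑ _j : Fin N, Real.exp (|t| * ∑ j, |x j|) :=
            Finset.sum_le_sum fun j _ => Real.exp_le_exp.2 (le_of_abs_le (hj j))
        _ = _ := by simp [mul_comm]

/-- Jensen's inequality, through the tangent line of `log` at the mean `c` of the sum. -/
lemma expectedLogSumExp_le_log_add {N : ℕ} (hN : 1 ≤ N) (s : ℝ) :
    expectedLogSumExp N s ≤ Real.log N + s ^ 2 / 2 := by
  have : Nonempty (Fin N) := ⟨⟨0, hN⟩⟩
  have hN0 : (0 : ℝ) < N := by exact_mod_cast hN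
  set c : ℝ := N * Real.exp (s ^ 2 / 2) with hc
  have hcpos : 0 < c := by positivity
  have hint : ∀ j : Fin N, Integrable (fun x : Fin N → ℝ => Real.exp (s * x j)) (stdNormalPi N) :=
    fun j => integrable_comp_eval (μ := fun _ : Fin N => gaussianReal 0 1) (i := j)
      (f := fun y : ℝ => Real.exp (s * y)) (integrable_exp_mul_gaussianReal s)
  have hval : ∫ x, ∑ j, Real.exp (s * x j) ∂stdNormalPi N = c := by
    rw [integral_finsetSum _ fun j _ => hint j]
    have : ∀ j : Fin N, ∫ x, Real.exp (s * x j) ∂stdNormalPi N = Real.exp (s ^ 2 / 2) := by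
      intro j
      rw [integral_comp_eval (μ := fun _ : Fin N => gaussianReal 0 1) (i := j)
        (f := fun y : ℝ => Real.exp (s * y)) (by fun_prop)]
      have h := congrFun (mgf_id_gaussianReal (μ := 0) (v := 1)) s
      simpa [mgf] using h
    simp [this, hc]
  calc expectedLogSumExp N s
      ≤ ∫ x, ((∑ j, Real.exp (s * x j)) / c + (Real.log c - 1)) ∂stdNormalPi N := by
        refine integral_mono (integrable_log_sum_exp N s)
          (((integrable_finsetSum _ fun j _ => hint j).div_const c).add (integrable_const _))
          fun x => ?_
        have hpos : 0 < ∑ j, Real.exp (s * x j) :=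
          Finset.sum_pos (fun j _ => Real.exp_pos _) Finset.univ_nonempty
        have h := Real.log_le_sub_one_of_pos (div_pos hpos hcpos)
        rw [Real.log_div hpos.ne' hcpos.ne'] at h
        simp only
        linarith
    _ = Real.log c := by
        rw [integral_add ((integrable_finsetSum _ fun j _ => hint j).div_const c)
          (integrable_const _), integral_div, hval, div_self hcpos.ne']
        simp
    _ = Real.log N + s ^ 2 / 2 := by
        rw [hc, Real.log_mul hN0.ne' (Real.exp_pos _).ne', Real.log_exp]

lemma expectedLogSumExp_le {N : ℕ} (hN : 2 ≤ N) {t : ℝ} (ht : √(2 * Real.log N) ≤ t) :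
    expectedLogSumExp N t ≤ t * √(2 * Real.log N) := by
  have : Nonempty (Fin N) := ⟨⟨0, by omega⟩⟩
  have hL : 0 < Real.log N := Real.log_pos (by exact_mod_cast hN)
  -- This `s` minimises the Jensen bound per unit of `s`, `(log N + s² / 2) / s`; there `log N + s²
  -- / 2 = s²`.
  set s := √(2 * Real.log N) with hs
  have hspos : 0 < s := Real.sqrt_pos.2 (by linarith)
  have hsq : s ^ 2 = 2 * Real.log N := Real.sq_sqrt (by linarith)
  calc expectedLogSumExp N t ≤ t / s * expectedLogSumExp N s := by
        rw [expectedLogSumExp, expectedLogSumExp, ← integral_const_mul]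
        exact integral_mono (integrable_log_sum_exp N t) ((integrable_log_sum_exp N s).const_mul _)
          fun x => log_sum_exp_le_mul hspos ht x
    _ ≤ t / s * (s ^ 2) := by
        refine mul_le_mul_of_nonneg_left ?_ (div_nonneg (hspos.le.trans ht) hspos.le)
        have := expectedLogSumExp_le_log_add (N := N) (by omega) s
        linarith
    _ = t * s := by field_simp

/-- On `(u, u + 1/u]` the density loses only a constant factor relative to its value at `u`: `(u +
1/u)² ≤ u² + 3` for `u ≥ 1`, whence `exp (-3/2)`. -/
lemma gaussian_tail_lower_bound {u : ℝ} (hu : 1 ≤ u) :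
    (√(2 * Real.pi))⁻¹ * Real.exp (-(3 / 2)) / u * Real.exp (-u ^ 2 / 2) ≤
      (gaussianReal 0 1).real (Set.Ioi u) := by
  have hu0 : 0 < u := by linarith
  set a := gaussianPDFReal 0 1 (u + 1 / u) with ha
  have h1 : (gaussianReal 0 1).real (Set.Ioi u) = ∫ x in Set.Ioi u, gaussianPDFReal 0 1 x := by
    rw [measureReal_def, gaussianReal_apply_eq_integral 0 one_ne_zero,
      ENNReal.toReal_ofReal (integral_nonneg fun x => gaussianPDFReal_nonneg _ _ _)]
  have h2 : ∫ x in Set.Ioc u (u + 1 / u), gaussianPDFReal 0 1 x ≤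
      ∫ x in Set.Ioi u, gaussianPDFReal 0 1 x :=
    setIntegral_mono_set (integrable_gaussianPDFReal 0 1).integrableOn
      (ae_of_all _ fun x => gaussianPDFReal_nonneg _ _ _)
      (Set.Ioc_subset_Ioi_self).eventuallyLE
  have h3 : 1 / u * a ≤ ∫ x in Set.Ioc u (u + 1 / u), gaussianPDFReal 0 1 x := by
    have h4 : ∫ _x in Set.Ioc u (u + 1 / u), a = 1 / u * a := by
      simp [measureReal_def, hu0.le]
    rw [← h4]
    refine setIntegral_mono_on (by simp) (integrable_gaussianPDFReal 0 1).integrableOn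
      measurableSet_Ioc fun x hx => ?_
    simp only [ha, gaussianPDFReal]
    refine mul_le_mul_of_nonneg_left (Real.exp_le_exp.2 ?_) (by positivity)
    have := pow_le_pow_left₀ (hu0.le.trans hx.1.le) hx.2 2
    simp only [sub_zero, NNReal.coe_one, mul_one]
    linarith
  have h5 : (√(2 * Real.pi))⁻¹ * Real.exp (-(3 / 2)) / u * Real.exp (-u ^ 2 / 2) ≤ 1 / u * a := by
    have h6 : Real.exp (-(3 / 2)) * Real.exp (-u ^ 2 / 2) ≤ Real.exp (-(u + 1 / u) ^ 2 / 2) := by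
      rw [← Real.exp_add, Real.exp_le_exp]
      have h7 : (u + 1 / u) ^ 2 = u ^ 2 + 2 + (1 / u) ^ 2 := by field_simp; ring
      have h8 : (1 / u) ^ 2 ≤ 1 := pow_le_one₀ (by positivity) (by rw [div_le_one hu0]; exact hu)
      rw [neg_div, neg_div, h7]
      linarith
    simp only [ha, gaussianPDFReal, sub_zero, NNReal.coe_one, mul_one]
    calc _ = (1 / u * (√(2 * Real.pi))⁻¹) * (Real.exp (-(3 / 2)) * Real.exp (-u ^ 2 / 2)) := by
          ring
      _ ≤ (1 / u * (√(2 * Real.pi))⁻¹) * Real.exp (-(u + 1 / u) ^ 2 / 2) :=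
          mul_le_mul_of_nonneg_left h6 (by positivity)
      _ = _ := by ring
  linarith

/-- If some variable other than the first exceeds `u` the maximum exceeds `u`; otherwise it is at
least the first variable, which is centred and independent of the others. -/
lemma le_expectedLogSumExp (n : ℕ) {t : ℝ} (ht : 0 ≤ t) (u : ℝ) :
    t * (u * (1 - (gaussianReal 0 1).real (Set.Iic u) ^ n)) ≤ expectedLogSumExp (n + 1) t := by
  let g : ℝ → ℝ := (Set.Iic u).indicator 1
  have hg : Integrable g (gaussianReal 0 1) := (integrable_const (1 : ℝ)).indicator measurableSet_Iic
  have hgval : ∫ y, g y ∂gaussianReal 0 1 = (gaussianReal 0 1).real (Set.Iic u) :=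
    integral_indicator_one measurableSet_Iic
  -- Written as products over all coordinates, both integrands factor under the product measure; the
  -- mean of coordinate `0` kills the second.
  let f₁ : Fin (n + 1) → ℝ → ℝ := Fin.cons (fun _ => 1) fun _ => g
  let f₂ : Fin (n + 1) → ℝ → ℝ := Fin.cons (fun y => y) fun _ => g
  have hf₁ : ∀ x : Fin (n + 1) → ℝ, ∏ i, f₁ i (x i) = ∏ j : Fin n, g (x j.succ) := fun x => by
    simp [Fin.prod_univ_succ, f₁]
  have hf₂ : ∀ x : Fin (n + 1) → ℝ, ∏ i, f₂ i (x i) = x 0 * ∏ j : Fin n, g (x j.succ) := fun x => by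
    simp [Fin.prod_univ_succ, f₂]
  have i₁ : Integrable (fun x : Fin (n + 1) → ℝ => ∏ j : Fin n, g (x j.succ))
      (stdNormalPi (n + 1)) := by
    simp_rw [← hf₁]
    refine Integrable.fintype_prod fun i => ?_
    refine Fin.cases ?_ (fun j => ?_) i
    · exact integrable_const (1 : ℝ)
    · exact hg
  have i₂ : Integrable (fun x : Fin (n + 1) → ℝ => x 0 * ∏ j : Fin n, g (x j.succ))
      (stdNormalPi (n + 1)) := by
    simp_rw [← hf₂]
    refine Integrable.fintype_prod fun i => ?_
    refine Fin.cases ?_ (fun j => ?_) i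
    · exact integrable_id_stdNormal
    · exact hg
  have v₁ : ∫ x : Fin (n + 1) → ℝ, ∏ j : Fin n, g (x j.succ) ∂stdNormalPi (n + 1) =
      (gaussianReal 0 1).real (Set.Iic u) ^ n := by
    simp_rw [← hf₁]
    rw [integral_fintype_prod_eq_prod, Fin.prod_univ_succ]
    simp [f₁, hgval]
  have v₂ : ∫ x : Fin (n + 1) → ℝ, x 0 * ∏ j : Fin n, g (x j.succ) ∂stdNormalPi (n + 1) = 0 := by
    simp_rw [← hf₂]
    rw [integral_fintype_prod_eq_prod, Fin.prod_univ_succ]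
    simp [f₂, integral_id_gaussianReal]
  have hpt : ∀ x : Fin (n + 1) → ℝ,
      t * (u * (1 - ∏ j : Fin n, g (x j.succ)) + x 0 * ∏ j : Fin n, g (x j.succ)) ≤
        Real.log (∑ j, Real.exp (t * x j)) := by
    intro x
    by_cases h : ∃ j : Fin n, u < x j.succ
    · obtain ⟨j, hj⟩ := h
      have h0 : ∏ j : Fin n, g (x j.succ) = 0 :=
        Finset.prod_eq_zero (Finset.mem_univ j) (Set.indicator_of_notMem (by simpa using hj) _)
      rw [h0]
      have := mul_le_mul_of_nonneg_left hj.le ht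
      have := mul_le_log_sum_exp t x j.succ
      linarith
    · push Not at h
      have h1 : ∏ j : Fin n, g (x j.succ) = 1 :=
        Finset.prod_eq_one fun j _ => Set.indicator_of_mem (Set.mem_Iic.2 (h j)) _
      rw [h1]
      have := mul_le_log_sum_exp t x 0
      linarith
  have i₃ : Integrable (fun x : Fin (n + 1) → ℝ => u * (1 - ∏ j : Fin n, g (x j.succ)))
      (stdNormalPi (n + 1)) := ((integrable_const (1 : ℝ)).sub i₁).const_mul u
  calc t * (u * (1 - (gaussianReal 0 1).real (Set.Iic u) ^ n))
      = ∫ x : Fin (n + 1) → ℝ, t * (u * (1 - ∏ j : Fin n, g (x j.succ)) +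
          x 0 * ∏ j : Fin n, g (x j.succ)) ∂stdNormalPi (n + 1) := by
        rw [integral_const_mul, integral_add i₃ i₂, v₂, integral_const_mul,
          integral_sub (integrable_const _) i₁, v₁]
        simp
    _ ≤ _ := integral_mono ((i₃.add i₂).const_mul t) (integrable_log_sum_exp _ _) hpt

lemma exists_expectedLogSumExp_bound :
    ∃ C : ℝ, ∀ᶠ N : ℕ in atTop, ∀ t : ℝ, √(2 * Real.log N) ≤ t →
      |expectedLogSumExp N t - t * √(2 * Real.log N)| ≤
        C * (t * (Real.log (Real.log N) / √(Real.log N))) := by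
  set c : ℝ := (√(2 * Real.pi))⁻¹ * Real.exp (-(3 / 2)) with hc
  have hcpos : 0 < c := by positivity
  -- `4` pays for `s - u`, and `4 / c` for `u * p ^ n`.
  refine ⟨4 + 4 / c, ?_⟩
  have hlog : Tendsto (fun N : ℕ => Real.log (N : ℝ)) atTop atTop :=
    Real.tendsto_log_atTop.comp tendsto_natCast_atTop_atTop
  -- Ensures `u² = 2L - 4ℓ ≥ L ≥ 1` below, as the tail bound requires.
  have hsmall : ∀ᶠ L : ℝ in atTop, 4 * Real.log L ≤ L := by
    filter_upwards [Real.isLittleO_log_id_atTop.bound (show (0 : ℝ) < 1 / 4 by norm_num),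
      eventually_ge_atTop 1] with L h h1
    have h2 := le_of_abs_le h
    rw [id, Real.norm_eq_abs, abs_of_nonneg (by linarith)] at h2
    linarith
  filter_upwards [eventually_ge_atTop 2, hlog.eventually hsmall,
    hlog.eventually (eventually_ge_atTop 1),
    (Real.tendsto_log_atTop.comp hlog).eventually (eventually_ge_atTop 1)]
    with N hN hL4 hL1 hLL t ht
  simp only [Function.comp] at hLL
  set L := Real.log N with hLdef
  have hLpos : 0 < L := by linarith
  set ℓ := Real.log L with hℓ
  obtain ⟨n, rfl⟩ : ∃ n, N = n + 1 := ⟨N - 1, by omega⟩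
  have hn : 1 ≤ n := by omega
  have hnR : (1 : ℝ) ≤ n := by exact_mod_cast hn
  have ht0 : 0 ≤ t := (Real.sqrt_nonneg _).trans ht
  have hup := expectedLogSumExp_le hN ht
  set s := √(2 * L) with hs
  -- Lowering `s²` by `4ℓ` gives `exp (-u² / 2) = L² / N`. Then `n * q` is at least of order `L² /
  -- u`, so `u * p ^ n = O(1 / L)`, while `s - u` is still only `O(ℓ / √L)`.
  set u := √(2 * L - 4 * ℓ) with hudef
  have husq : u ^ 2 = 2 * L - 4 * ℓ := Real.sq_sqrt (by linarith)
  have hssq : s ^ 2 = 2 * L := Real.sq_sqrt (by linarith)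
  have hu1 : 1 ≤ u := by rw [hudef, Real.one_le_sqrt]; linarith
  have hrL : √L ^ 2 = L := Real.sq_sqrt hLpos.le
  have hrL1 : 1 ≤ √L := by rw [Real.one_le_sqrt]; exact hL1
  have hsL : √L ≤ s := Real.sqrt_le_sqrt (by linarith)
  have hlow := le_expectedLogSumExp n ht0 u
  set p := (gaussianReal 0 1).real (Set.Iic u) with hp
  set q := (gaussianReal 0 1).real (Set.Ioi u) with hq
  have hpq : p = 1 - q := by
    rw [hp, hq, ← probReal_compl_eq_one_sub measurableSet_Ioi, Set.compl_Ioi]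
  have hexp : Real.exp (-u ^ 2 / 2) = L ^ 2 / (n + 1 : ℝ) := by
    have : -u ^ 2 / 2 = ℓ + ℓ - L := by rw [neg_div, husq]; ring
    rw [this, Real.exp_sub, Real.exp_add, hℓ, Real.exp_log hLpos, hLdef,
      Real.exp_log (by positivity)]
    push_cast
    ring
  have hqlow : c / u * (L ^ 2 / (n + 1 : ℝ)) ≤ q := hexp ▸ gaussian_tail_lower_bound hu1
  have hu0 : 0 < u := by linarith
  have hnq : c * L ^ 2 / (2 * u) ≤ n * q := by
    calc c * L ^ 2 / (2 * u) = c * L ^ 2 / u * (1 / 2) := by ring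
      _ ≤ c * L ^ 2 / u * (n / (n + 1)) := by
          refine mul_le_mul_of_nonneg_left ?_ (by positivity)
          rw [div_le_div_iff₀ (by norm_num) (by positivity)]
          linarith
      _ = n * (c / u * (L ^ 2 / (n + 1 : ℝ))) := by ring
      _ ≤ n * q := mul_le_mul_of_nonneg_left hqlow (by positivity)
  have hnqpos : 0 < n * q := lt_of_lt_of_le (by positivity) hnq
  have hpn : p ^ n ≤ 1 / (n * q) := by
    have hp0 : 0 ≤ p := measureReal_nonneg
    have h1 : p ≤ Real.exp (-q) := by
      have := Real.add_one_le_exp (-q)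
      linarith
    calc p ^ n ≤ Real.exp (-q) ^ n := pow_le_pow_left₀ hp0 h1 n
      _ = (Real.exp (n * q))⁻¹ := by rw [← Real.exp_nat_mul, ← Real.exp_neg]; congr 1; ring
      _ ≤ 1 / (n * q) := by
          rw [one_div]
          exact inv_anti₀ hnqpos (by have := Real.add_one_le_exp (n * q); linarith)
  have hupn : u * p ^ n ≤ 4 / c * (ℓ / √L) := by
    calc u * p ^ n ≤ u * (1 / (c * L ^ 2 / (2 * u))) :=
          mul_le_mul_of_nonneg_left
            (hpn.trans (one_div_le_one_div_of_le (by positivity) hnq)) hu0.le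
      _ = 2 * u ^ 2 / (c * L ^ 2) := by field_simp
      _ ≤ 2 * (2 * L) / (c * L ^ 2) := by
          refine div_le_div_of_nonneg_right ?_ (by positivity)
          linarith
      _ = 4 / c * (1 / L) := by field_simp; ring
      _ ≤ 4 / c * (ℓ / √L) := by
          refine mul_le_mul_of_nonneg_left ?_ (by positivity)
          refine div_le_div₀ (by linarith) hLL (by linarith) ?_
          nlinarith
  have hsu : s - u ≤ 4 * (ℓ / √L) := by
    have h1 : (s - u) * √L ≤ 4 * ℓ := by
      have h2 : u ≤ s := Real.sqrt_le_sqrt (by linarith)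
      calc (s - u) * √L ≤ (s - u) * (s + u) :=
            mul_le_mul_of_nonneg_left (by linarith) (by linarith)
        _ = 4 * ℓ := by linear_combination hssq - husq
    rw [← mul_div_assoc, le_div_iff₀ (by linarith)]
    exact h1
  have hℓpos : 0 ≤ ℓ / √L := by positivity
  rw [abs_le]
  constructor
  · have h1 : t * (s - u * (1 - p ^ n)) ≤ t * ((4 + 4 / c) * (ℓ / √L)) :=
      mul_le_mul_of_nonneg_left (by linarith) ht0
    linarith
  · have : 0 ≤ (4 + 4 / c) * (t * (ℓ / √L)) := by positivity
    linarith

/-! ### Reduction of log-normal weights to standard normal variables -/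

lemma hasLaw_stdNormalPi {Ω : Type*} [MeasurableSpace Ω] {μ : Measure Ω} {X : Ω → ℝ}
    (hX : HasLaw X (gaussianReal 0 1) μ) (N : ℕ) :
    HasLaw (fun (z : Fin N → Ω) j => X (z j)) (stdNormalPi N) (Measure.pi fun _ => μ) := by
  have : IsProbabilityMeasure μ := hX.isProbabilityMeasure
  have hs : ∀ _ : Fin N, SigmaFinite (μ.map X) := fun _ => by rw [hX.map_eq]; infer_instance
  refine ⟨aemeasurable_pi_lambda _ fun j => ?_, ?_⟩
  · exact hX.aemeasurable.comp_quasiMeasurePreserving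
      (Measure.quasiMeasurePreserving_eval (μ := fun _ : Fin N => μ) j)
  · have h := Measure.pi_map_pi (μ := fun _ : Fin N => μ) (f := fun _ => X)
      fun _ => hX.aemeasurable
    rw [h, hX.map_eq]

namespace LatentModel

variable {d : ℕ} {M : LatentModel d} {σ : ℝ}

lemma HasLogNormalWeights.exists_weight_eq (h : M.HasLogNormalWeights σ) (hσ : 0 < σ)
    (hd : 1 ≤ d) :
    ∃ X : EuclideanSpace ℝ (Fin d) → ℝ, HasLaw X (gaussianReal 0 1) M.encMeasure ∧
      ∀ᵐ z ∂M.encMeasure,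
        M.weight z = Real.exp (M.logLik - σ ^ 2 * d / 2 + σ * √(d : ℝ) * X z) := by
  obtain ⟨S, hS, hae⟩ := h
  have hd0 : (0 : ℝ) < d := by exact_mod_cast hd
  have hev : 0 < M.evidence := M.joint_integral_pos
  refine ⟨-S, by simpa using gaussianReal_neg hS, ?_⟩
  -- Since `Real.log 0 = 0`, the log-normal identity alone permits a zero weight, but only where `S`
  -- equals this one value, a null event.
  have hne : ∀ᵐ z ∂M.encMeasure, S z ≠ -(σ * √(d : ℝ) / 2) := by
    rw [hS.ae_iff (p := fun y => y ≠ -(σ * √(d : ℝ) / 2)) (by fun_prop)]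
    have := nullSingletonClass_gaussianReal (μ := 0) (one_ne_zero (α := NNReal))
    simp [ae_iff]
  filter_upwards [hae, hne] with z hz hne
  have hsq : √(d : ℝ) ^ 2 = d := Real.sq_sqrt hd0.le
  have hsqpos : 0 < √(d : ℝ) := Real.sqrt_pos.2 hd0
  have hw : M.relWeight z ≠ 0 := by
    intro h0
    rw [h0, Real.log_zero] at hz
    apply hne
    have : σ * √(d : ℝ) * (S z + σ * √(d : ℝ) / 2) = 0 := by
      linear_combination hz + σ ^ 2 / 2 * hsq
    rcases mul_eq_zero.1 this with h | h
    · exact absurd h (by positivity)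
    · linarith
  have hnn : 0 ≤ M.relWeight z :=
    div_nonneg (div_nonneg (M.joint_nonneg z) (M.enc_nonneg z)) hev.le
  have hrel : M.relWeight z = Real.exp (-(σ ^ 2 * (d : ℝ) / 2) - σ * √(d : ℝ) * S z) := by
    rw [← hz, Real.exp_log (lt_of_le_of_ne hnn hw.symm)]
  have : M.weight z = M.evidence * M.relWeight z := by
    rw [relWeight, mul_div_cancel₀ _ hev.ne']
  rw [this, hrel]
  nth_rewrite 1 [← Real.exp_log hev]
  rw [← Real.exp_add, logLik, Pi.neg_apply]
  congr 1
  ring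

lemma HasLogNormalWeights.elbo_sub_logLik (h : M.HasLogNormalWeights σ) (hσ : 0 < σ)
    (hd : 1 ≤ d) : M.elbo - M.logLik = -(d * σ ^ 2 / 2) := by
  obtain ⟨X, hX, hw⟩ := h.exists_weight_eq hσ hd
  have : IsProbabilityMeasure M.encMeasure := hX.isProbabilityMeasure
  have hint : Integrable X M.encMeasure := by
    have h1 := integrable_id_stdNormal
    rw [← hX.map_eq] at h1
    exact (integrable_map_measure (by fun_prop) hX.aemeasurable).1 h1
  have hzero : ∫ z, X z ∂M.encMeasure = 0 := by rw [hX.integral_eq, integral_id_gaussianReal]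
  have : M.elbo = M.logLik - σ ^ 2 * d / 2 := by
    calc M.elbo = ∫ z, (M.logLik - σ ^ 2 * d / 2 + σ * √(d : ℝ) * X z) ∂M.encMeasure := by
          refine integral_congr_ae ?_
          filter_upwards [hw] with z hz
          rw [hz, Real.log_exp]
      _ = M.logLik - σ ^ 2 * d / 2 := by
          rw [integral_add (integrable_const _) (hint.const_mul _), integral_const_mul, hzero]
          simp
  rw [this]
  ring

lemma HasLogNormalWeights.logMeanWeight_law (h : M.HasLogNormalWeights σ) (hσ : 0 < σ)
    (hd : 1 ≤ d) (α : ℝ) {N : ℕ} (hN : 1 ≤ N) :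
    Integrable (M.logMeanWeight α N) (M.sampleMeasure N) ∧
      ∫ z, M.logMeanWeight α N z ∂M.sampleMeasure N =
        (1 - α) * (M.logLik - σ ^ 2 * d / 2) - Real.log N +
          expectedLogSumExp N ((1 - α) * σ * √(d : ℝ)) := by
  obtain ⟨X, hX, hw⟩ := h.exists_weight_eq hσ hd
  have : IsProbabilityMeasure M.encMeasure := hX.isProbabilityMeasure
  have : Nonempty (Fin N) := ⟨⟨0, hN⟩⟩
  have hN0 : (0 : ℝ) < N := by exact_mod_cast hN
  have hlaw : HasLaw (fun (z : Fin N → EuclideanSpace ℝ (Fin d)) j => X (z j)) (stdNormalPi N)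
      (M.sampleMeasure N) := hasLaw_stdNormalPi hX N
  set t := (1 - α) * σ * √(d : ℝ) with ht
  set k := (1 - α) * (M.logLik - σ ^ 2 * d / 2) with hk
  let G : (Fin N → ℝ) → ℝ := fun x => k - Real.log N + Real.log (∑ j, Real.exp (t * x j))
  have hG : Integrable G (stdNormalPi N) := (integrable_const _).add (integrable_log_sum_exp N t)
  have hwall : ∀ᵐ z ∂M.sampleMeasure N, ∀ j : Fin N, M.weight (z j) =
      Real.exp (M.logLik - σ ^ 2 * d / 2 + σ * √(d : ℝ) * X (z j)) :=
    ae_all_iff.2 fun j =>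
      (Measure.tendsto_eval_ae_ae (μ := fun _ : Fin N => M.encMeasure) (i := j)).eventually hw
  have hae : M.logMeanWeight α N =ᵐ[M.sampleMeasure N] G ∘ fun z j => X (z j) := by
    filter_upwards [hwall] with z hz
    have hpos : 0 < ∑ j, Real.exp (t * X (z j)) :=
      Finset.sum_pos (fun j _ => Real.exp_pos _) Finset.univ_nonempty
    have h1 : ∀ j, M.weight (z j) ^ (1 - α) = Real.exp k * Real.exp (t * X (z j)) := fun j => by
      rw [hz j, ← Real.exp_mul, ← Real.exp_add]
      congr 1
      rw [hk, ht]
      ring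
    simp only [logMeanWeight, Function.comp, G]
    rw [Finset.sum_congr rfl fun j _ => h1 j, ← Finset.mul_sum,
      Real.log_mul (by positivity) (by positivity), Real.log_mul (Real.exp_pos _).ne' hpos.ne',
      Real.log_exp, one_div, Real.log_inv]
    ring
  constructor
  · refine Integrable.congr ?_ hae.symm
    rw [← hlaw.map_eq] at hG
    exact (integrable_map_measure hG.aestronglyMeasurable hlaw.aemeasurable).1 hG
  · rw [integral_congr_ae hae, hlaw.integral_comp hG.aestronglyMeasurable,
      integral_add (integrable_const _) (integrable_log_sum_exp N t)]
    simp [expectedLogSumExp]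

lemma HasLogNormalWeights.gap_eq (h : M.HasLogNormalWeights σ) (hσ : 0 < σ)
    (hd : 1 ≤ d) {α : ℝ} (hα : α < 1) {N : ℕ} (hN : 1 ≤ N) :
    M.gap α N = -(σ ^ 2 * d / 2) - Real.log N / (1 - α) +
      expectedLogSumExp N ((1 - α) * σ * √(d : ℝ)) / (1 - α) := by
  have hβ : 1 - α ≠ 0 := by linarith
  rw [gap, vrIwae, (h.logMeanWeight_law hσ hd α hN).2]
  field_simp
  ring

end LatentModel

/-! ### The regime `log N / d → 0` -/

lemma tendsto_fst_subexpRegime : Tendsto Prod.fst subexpRegime atTop :=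
  tendsto_fst.mono_left inf_le_left

lemma tendsto_snd_subexpRegime : Tendsto Prod.snd subexpRegime atTop :=
  tendsto_snd.mono_left inf_le_left

lemma tendsto_log_div_subexpRegime :
    Tendsto (fun p : ℕ × ℕ => Real.log (p.1 : ℝ) / (p.2 : ℝ)) subexpRegime (𝓝 0) :=
  tendsto_comap.mono_left inf_le_right

lemma tendsto_log_fst_subexpRegime :
    Tendsto (fun p : ℕ × ℕ => Real.log (p.1 : ℝ)) subexpRegime atTop :=
  Real.tendsto_log_atTop.comp (tendsto_natCast_atTop_atTop.comp tendsto_fst_subexpRegime)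

/-- The quotient is `(log log N / log N) * √(log N / d)`, and both factors vanish. -/
lemma tendsto_loglog_div_subexpRegime :
    Tendsto (fun p : ℕ × ℕ => Real.log (Real.log (p.1 : ℝ)) / √((p.2 : ℝ) * Real.log (p.1 : ℝ)))
      subexpRegime (𝓝 0) := by
  have h1 : Tendsto (fun p : ℕ × ℕ => Real.log (Real.log (p.1 : ℝ)) / Real.log (p.1 : ℝ))
      subexpRegime (𝓝 0) :=
    (Real.isLittleO_log_id_atTop.tendsto_div_nhds_zero).comp tendsto_log_fst_subexpRegime
  have h2 := h1.mul ((Real.continuous_sqrt.tendsto 0).comp tendsto_log_div_subexpRegime)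
  rw [Real.sqrt_zero, mul_zero] at h2
  refine h2.congr' ?_
  filter_upwards [tendsto_log_fst_subexpRegime.eventually_gt_atTop 0,
    tendsto_snd_subexpRegime.eventually_gt_atTop 0] with p hL hd
  have hd0 : (0 : ℝ) < p.2 := by exact_mod_cast hd
  simp only [Function.comp]
  rw [Real.sqrt_div hL.le, Real.sqrt_mul hd0.le]
  have h3 : √(Real.log (p.1 : ℝ)) ^ 2 = Real.log p.1 := Real.sq_sqrt hL.le
  have h4 : 0 < √(Real.log (p.1 : ℝ)) := Real.sqrt_pos.2 hL
  have h5 : 0 < √(p.2 : ℝ) := Real.sqrt_pos.2 hd0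
  rw [div_mul_div_comm, div_eq_div_iff (by positivity) (by positivity)]
  linear_combination Real.log (Real.log (p.1 : ℝ)) * √(p.2 : ℝ) * h3

theorem theorem4 (σ : ℝ) (hσ : 0 < σ) (M : (d : ℕ) → LatentModel d)
    (hM : ∀ d : ℕ, 1 ≤ d → (M d).HasLogNormalWeights σ)
    (α : ℝ) (hα : α ∈ Set.Ico (0 : ℝ) 1) :
    (∀ N d : ℕ, 1 ≤ N → 1 ≤ d →
      Integrable ((M d).logMeanWeight α N) ((M d).sampleMeasure N)) ∧
    (∃ r : ℕ × ℕ → ℝ,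
      r =O[subexpRegime] (fun p : ℕ × ℕ =>
        Real.log (Real.log (p.1 : ℝ)) / √((p.2 : ℝ) * Real.log (p.1 : ℝ))) ∧
      Tendsto (fun p : ℕ × ℕ =>
        (M p.2).gap α p.1 + (p.2 : ℝ) * σ ^ 2 / 2 *
          (1 - 2 * √(2 * Real.log (p.1 : ℝ) / ((p.2 : ℝ) * σ ^ 2))
            + 1 / (1 - α) * (2 * Real.log (p.1 : ℝ) / ((p.2 : ℝ) * σ ^ 2))
            + r p)) subexpRegime (𝓝 0)) ∧
    (∀ d : ℕ, 1 ≤ d → (M d).elbo - (M d).logLik = -((d : ℝ) * σ ^ 2 / 2)) ∧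
    Tendsto (fun p : ℕ × ℕ => (M p.2).gap α p.1 / ((M p.2).elbo - (M p.2).logLik))
      subexpRegime (𝓝 1) := by
  have hβ : 0 < 1 - α := by linarith [hα.2]
  have helbo : ∀ d : ℕ, 1 ≤ d → (M d).elbo - (M d).logLik = -((d : ℝ) * σ ^ 2 / 2) :=
    fun d hd => (hM d hd).elbo_sub_logLik hσ hd
  let m : ℕ × ℕ → ℝ := fun p =>
    1 - 2 * √(2 * Real.log (p.1 : ℝ) / ((p.2 : ℝ) * σ ^ 2))
      + 1 / (1 - α) * (2 * Real.log (p.1 : ℝ) / ((p.2 : ℝ) * σ ^ 2))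
  -- Solving for `r` makes the bracket in the limit vanish identically once `d > 0`; the content
  -- lies in the bound `hr`.
  let r : ℕ × ℕ → ℝ := fun p => -((M p.2).gap α p.1 / ((p.2 : ℝ) * σ ^ 2 / 2)) - m p
  have hgap : ∀ᶠ p in subexpRegime, (M p.2).gap α p.1 = -((p.2 : ℝ) * σ ^ 2 / 2) * (m p + r p) := by
    filter_upwards [tendsto_snd_subexpRegime.eventually_gt_atTop 0] with p hd
    have hd0 : (0 : ℝ) < p.2 := by exact_mod_cast hd
    simp only [r]
    field_simp
    ring
  have hratio : Tendsto (fun p : ℕ × ℕ => 2 * Real.log (p.1 : ℝ) / ((p.2 : ℝ) * σ ^ 2))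
      subexpRegime (𝓝 0) := by
    have h := tendsto_log_div_subexpRegime.const_mul (2 / σ ^ 2)
    rw [mul_zero] at h
    refine h.congr fun p => ?_
    rw [div_mul_div_comm, mul_comm (σ ^ 2)]
  have hm : Tendsto m subexpRegime (𝓝 1) := by
    have h := (((Real.continuous_sqrt.tendsto 0).comp hratio).const_mul 2).const_sub 1 |>.add
      (hratio.const_mul (1 / (1 - α)))
    simpa [m] using h
  have hr : r =O[subexpRegime] (fun p : ℕ × ℕ =>
      Real.log (Real.log (p.1 : ℝ)) / √((p.2 : ℝ) * Real.log (p.1 : ℝ))) := by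
    obtain ⟨C, hC⟩ := exists_expectedLogSumExp_bound
    refine IsBigO.of_bound (2 * C / σ) ?_
    -- Equivalent to `√(2 log N) ≤ t`, the range of the uniform estimate.
    have hsmall : ∀ᶠ p : ℕ × ℕ in subexpRegime,
        2 * Real.log (p.1 : ℝ) / ((p.2 : ℝ) * σ ^ 2) ≤ (1 - α) ^ 2 :=
      hratio.eventually_le_const (by positivity)
    filter_upwards [tendsto_fst_subexpRegime.eventually hC, hsmall,
      tendsto_fst_subexpRegime.eventually_ge_atTop 1,
      tendsto_snd_subexpRegime.eventually_ge_atTop 1,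
      tendsto_log_fst_subexpRegime.eventually_ge_atTop 1] with p hbound hsm hN hd hL
    have hd0 : (0 : ℝ) < p.2 := by exact_mod_cast hd
    have hsd : 0 < √(p.2 : ℝ) := Real.sqrt_pos.2 hd0
    have hsdsq : √(p.2 : ℝ) ^ 2 = p.2 := Real.sq_sqrt hd0.le
    set L := Real.log (p.1 : ℝ)
    have hLpos : 0 < L := by linarith
    have hℓ : 0 ≤ Real.log L := Real.log_nonneg hL
    set t := (1 - α) * σ * √(p.2 : ℝ) with ht
    have hst : √(2 * L) ≤ t := by
      refine Real.sqrt_le_iff.2 ⟨by positivity, ?_⟩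
      rw [div_le_iff₀ (by positivity)] at hsm
      calc 2 * L ≤ (1 - α) ^ 2 * (p.2 * σ ^ 2) := hsm
        _ = t ^ 2 := by rw [ht, mul_pow, mul_pow, hsdsq]; ring
    have hr_eq : r p = -(2 / (p.2 * σ ^ 2 * (1 - α))) *
        (expectedLogSumExp p.1 t - t * √(2 * L)) := by
      have h1 : √(2 * L / (p.2 * σ ^ 2)) = √(2 * L) / (√(p.2 : ℝ) * σ) := by
        rw [Real.sqrt_div (by positivity), Real.sqrt_mul hd0.le, Real.sqrt_sq hσ.le]
      simp only [r, m]
      rw [(hM p.2 hd).gap_eq hσ hd hα.2 hN, ← ht, h1]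
      have h2 : √(2 * L) / (√(p.2 : ℝ) * σ) = t * √(2 * L) / (p.2 * σ ^ 2 * (1 - α)) := by
        rw [ht, ← hsdsq, Real.sqrt_sq hsd.le]
        field_simp
      rw [h2]
      field_simp
      ring
    rw [hr_eq, norm_mul, norm_neg, Real.norm_of_nonneg (by positivity), Real.norm_eq_abs,
      Real.norm_of_nonneg (by positivity)]
    calc 2 / (p.2 * σ ^ 2 * (1 - α)) * |expectedLogSumExp p.1 t - t * √(2 * L)|
        ≤ 2 / (p.2 * σ ^ 2 * (1 - α)) * (C * (t * (Real.log L / √L))) :=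
          mul_le_mul_of_nonneg_left (hbound t hst) (by positivity)
      _ = 2 * C / σ * (Real.log L / √(p.2 * L)) := by
          rw [Real.sqrt_mul hd0.le, ht]
          nth_rewrite 1 [← hsdsq]
          field_simp
  refine ⟨fun N d hN hd => ((hM d hd).logMeanWeight_law hσ hd α hN).1, ⟨r, hr, ?_⟩, helbo, ?_⟩
  · refine tendsto_const_nhds.congr' ?_
    filter_upwards [hgap] with p hp
    rw [hp]
    simp only [m]
    ring
  · have hmr : Tendsto (fun p => m p + r p) subexpRegime (𝓝 1) := by
      simpa using hm.add (hr.trans_tendsto tendsto_loglog_div_subexpRegime)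
    refine hmr.congr' ?_
    filter_upwards [hgap, tendsto_snd_subexpRegime.eventually_ge_atTop 1] with p hp hd
    have hd0 : (0 : ℝ) < p.2 := by exact_mod_cast hd
    rw [helbo p.2 hd, hp, mul_div_cancel_left₀]
    exact neg_ne_zero.2 (by positivity)
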